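/- Let $\mathcal H$ be a finite-dimensional complex Hilbert space, and let $\mathcal E:\mathcal L(\mathcal H)\to\mathcal L(\mathcal H)$ be a quantum channel, that is, a completely positive trace preserving linear map (not necessarily unital). Let $$MD(\mathcal E)=\{a\in\mathcal L(\mathcal H):\ \mathcal E(a)\mathcal E(b)=\mathcal E(ab)\text{ and }\mathcal E(b)\mathcal E(a)=\mathcal E(ba)\text{ for all }b\in\mathcal L(\mathcal H)\}$$ be its multiplicative domain. Suppose that $\mathcal H=\bigoplus_k(\mathcal A_k\otimes\mathcal B_k)\oplus\mathcal K$ is a finite orthogonal direct sum decomposition with respect to which $$MD(\mathcal E)=\bigoplus_k\big(I_{\mathcal A_k}\otimes\mathcal L(\mathcal B_k)\big)\oplus 0_{\mathcal K}.$$ Then every subsystem $\mathcal B_k$ (the codes encoded in $MD(\mathcal E)$) is unitarily correctable for $\mathcal E$: for each $k$ there are a unitary $U$ on $\mathcal H$ and a channel $\mathcal F$ on $\mathcal L(\mathcal A_k)$ such that $$\mathcal E(PXP)=U\,\big[(\mathcal F\otimes\mathrm{id}_{\mathcal B_k})(PXP)\big]\,U^\dagger\qquad\text{for all }X\in\mathcal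 L(\mathcal H),$$ where $P$ is the orthogonal projection of $\mathcal H$ onto $\mathcal A_k\otimes\mathcal B_k$, and operators on $\mathcal A_k\otimes\mathcal B_k$ are regarded as operators on $\mathcal H$ that vanish on its orthogonal complement. In particular, if $\dim\mathcal A_k=1$, then the subspace code $\mathcal C=\mathcal A_k\otimes\mathcal B_k$ is unitarily correctable: there is a unitary $U$ on $\mathcal H$ with $\mathcal E(PXP)=U\,PXP\,U^\dagger$ for all $X\in\mathcal L(\mathcal H)$. -/

import Mathlib

open scoped TensorProduct InnerProductSpace CStarAlgebra

noncomputable section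

namespace QuantumCodes

/-- The multiplicative domain of a map `φ` between two algebras: all `a` such that
`φ(a)φ(b) = φ(ab)` and `φ(b)φ(a) = φ(ba)` for every `b`. -/
def multiplicativeDomain {S T : Type*} [Mul S] [Mul T] (φ : S → T) : Set S :=
  {a | ∀ b, φ a * φ b = φ (a * b) ∧ φ b * φ a = φ (b * a)}

/-- A map on the operators on `H` is trace preserving. -/
def TracePreserving {H : Type*} [NormedAddCommGroup H] [InnerProductSpace ℂ H]
    (φ : (H →L[ℂ] H) → (H →L[ℂ] H)) : Prop :=
  ∀ X : H →L[ℂ] H,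
    LinearMap.trace ℂ H (φ X : H →ₗ[ℂ] H) = LinearMap.trace ℂ H (X : H →ₗ[ℂ] H)

instance instCompleteSpaceTensor {A B : Type*}
    [NormedAddCommGroup A] [InnerProductSpace ℂ A] [FiniteDimensional ℂ A]
    [NormedAddCommGroup B] [InnerProductSpace ℂ B] [FiniteDimensional ℂ B] :
    CompleteSpace (A ⊗[ℂ] B) :=
  FiniteDimensional.complete ℂ _

section Subsystem

variable {H A B : Type*}
  [NormedAddCommGroup H] [InnerProductSpace ℂ H] [CompleteSpace H]
  [NormedAddCommGroup A] [InnerProductSpace ℂ A] [FiniteDimensional ℂ A]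
  [NormedAddCommGroup B] [InnerProductSpace ℂ B] [FiniteDimensional ℂ B]

/-- A pair of subsystems `A`, `B` of `H` is given by an isometry `V : A ⊗ B → H`, which identifies
`A ⊗ B` with a subspace `C` of `H`. This is `V Y V†`, the operator `Y` on `A ⊗ B` regarded as the
operator `Y ⊕ 0` on `H = C ⊕ Cᗮ`. -/
def embed (V : A ⊗[ℂ] B →ₗᵢ[ℂ] H) (Y : A ⊗[ℂ] B →L[ℂ] A ⊗[ℂ] B) : H →L[ℂ] H :=
  V.toContinuousLinearMap ∘L Y ∘L V.toContinuousLinearMap.adjoint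

/-- `V† X V`, the compression of an operator `X` on `H` to the subspace `C = A ⊗ B`. This is
`P X P`, for `P` the orthogonal projection onto `C`, regarded as an operator on `A ⊗ B`. -/
def compress (V : A ⊗[ℂ] B →ₗᵢ[ℂ] H) (X : H →L[ℂ] H) : A ⊗[ℂ] B →L[ℂ] A ⊗[ℂ] B :=
  V.toContinuousLinearMap.adjoint ∘L X ∘L V.toContinuousLinearMap

/-- The orthogonal projection of `H` onto the subspace `C = A ⊗ B`. -/
def codeProjection (V : A ⊗[ℂ] B →ₗᵢ[ℂ] H) : H →L[ℂ] H := embed V 1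

end Subsystem

section TensorId

variable {A B : Type*}
  [NormedAddCommGroup A] [InnerProductSpace ℂ A] [FiniteDimensional ℂ A]
  [NormedAddCommGroup B] [InnerProductSpace ℂ B] [FiniteDimensional ℂ B]

/-- The identification `L(A) ⊗ L(B) ≃ L(A ⊗ B)`. -/
def operatorTensorEquiv (A B : Type*)
    [NormedAddCommGroup A] [InnerProductSpace ℂ A] [FiniteDimensional ℂ A]
    [NormedAddCommGroup B] [InnerProductSpace ℂ B] [FiniteDimensional ℂ B] :
    (A →L[ℂ] A) ⊗[ℂ] (B →L[ℂ] B) ≃ₗ[ℂ] (A ⊗[ℂ] B →L[ℂ] A ⊗[ℂ] B) :=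
  (TensorProduct.congr
      (LinearMap.toContinuousLinearMap (𝕜 := ℂ) (E := A) (F' := A)).symm
      (LinearMap.toContinuousLinearMap (𝕜 := ℂ) (E := B) (F' := B)).symm) ≪≫ₗ
    homTensorHomEquiv ℂ A B A B ≪≫ₗ
    LinearMap.toContinuousLinearMap (𝕜 := ℂ) (E := A ⊗[ℂ] B) (F' := A ⊗[ℂ] B)

theorem operatorTensorEquiv_tmul (σ : A →L[ℂ] A) (ρ : B →L[ℂ] B) :
    operatorTensorEquiv A B (σ ⊗ₜ ρ) = TensorProduct.mapL σ ρ := by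
  ext x
  simp only [operatorTensorEquiv, LinearEquiv.trans_apply, TensorProduct.congr_tmul,
    homTensorHomEquiv_apply, TensorProduct.homTensorHomMap_apply, TensorProduct.mapL_apply,
    LinearMap.coe_toContinuousLinearMap']
  rfl

/-- The linear map `F ⊗ id_B` on the operators on `A ⊗ B`. -/
def tensorId (F : (A →L[ℂ] A) →ₗ[ℂ] (A →L[ℂ] A)) :
    (A ⊗[ℂ] B →L[ℂ] A ⊗[ℂ] B) →ₗ[ℂ] (A ⊗[ℂ] B →L[ℂ] A ⊗[ℂ] B) :=
  (operatorTensorEquiv A B).toLinearMap ∘ₗ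
    TensorProduct.map F LinearMap.id ∘ₗ (operatorTensorEquiv A B).symm.toLinearMap

theorem tensorId_mapL (F : (A →L[ℂ] A) →ₗ[ℂ] (A →L[ℂ] A)) (σ : A →L[ℂ] A) (ρ : B →L[ℂ] B) :
    tensorId F (TensorProduct.mapL σ ρ) = TensorProduct.mapL (F σ) ρ := by
  have h : (operatorTensorEquiv A B).symm (TensorProduct.mapL σ ρ) = σ ⊗ₜ ρ := by
    rw [← operatorTensorEquiv_tmul, LinearEquiv.symm_apply_apply]
  simp [tensorId, h, operatorTensorEquiv_tmul]

end TensorId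

/-- The subsystem `B` of `C = A ⊗ B ⊆ H` is unitarily correctable for `E`: there are a unitary `U`
on `H` and a channel `F` on the operators on `A` such that
`E ∘ P_C = (U · U†) ∘ (F ⊗ id_B) ∘ P_C`, where `P_C(X) = P X P` with `P` the projection onto `C`. -/
def IsUnitarilyCorrectable {H A B : Type*}
    [NormedAddCommGroup H] [InnerProductSpace ℂ H] [CompleteSpace H]
    [NormedAddCommGroup A] [InnerProductSpace ℂ A] [CompleteSpace A] [FiniteDimensional ℂ A]
    [NormedAddCommGroup B] [InnerProductSpace ℂ B] [FiniteDimensional ℂ B]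
    (E : (H →L[ℂ] H) →CP (H →L[ℂ] H)) (V : A ⊗[ℂ] B →ₗᵢ[ℂ] H) : Prop :=
  ∃ U ∈ unitary (H →L[ℂ] H), ∃ F : (A →L[ℂ] A) →CP (A →L[ℂ] A), TracePreserving F ∧
    ∀ X : H →L[ℂ] H,
      E (codeProjection V * X * codeProjection V) =
        U * embed V (tensorId F.toLinearMap (compress V X)) * star U

/-- The subspace `C` of `H` is unitarily correctable for `E`: there is a unitary `U` on `H` with
`E(P X P) = U (P X P) U†` for every operator `X`, where `P` is the projection onto `C`. -/
def IsUnitarilyCorrectableSubspace {H : Type*}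
    [NormedAddCommGroup H] [InnerProductSpace ℂ H] [CompleteSpace H] [FiniteDimensional ℂ H]
    (E : (H →L[ℂ] H) →CP (H →L[ℂ] H)) (C : Submodule ℂ H) : Prop :=
  ∃ U ∈ unitary (H →L[ℂ] H), ∀ X : H →L[ℂ] H,
    E (C.starProjection * X * C.starProjection) =
      U * (C.starProjection * X * C.starProjection) * star U

/-- The isometries `V k : A k ⊗ B k → H` have mutually orthogonal ranges, so that
`H = ⨁ k, (A k ⊗ B k) ⊕ K` with `K` the orthogonal complement of all the ranges, and with respect
to this decomposition `𝔄 = ⨁ k, (I_{A k} ⊗ L(B k)) ⊕ 0_K`. The subsystems `B k` are the subsystem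
codes encoded in `𝔄`; those with `dim (A k) = 1` are its subspace codes. -/
structure IsBlockDecomposition {H ι : Type*} [Fintype ι] {A B : ι → Type*}
    [NormedAddCommGroup H] [InnerProductSpace ℂ H] [CompleteSpace H]
    [∀ k, NormedAddCommGroup (A k)] [∀ k, InnerProductSpace ℂ (A k)]
    [∀ k, FiniteDimensional ℂ (A k)]
    [∀ k, NormedAddCommGroup (B k)] [∀ k, InnerProductSpace ℂ (B k)]
    [∀ k, FiniteDimensional ℂ (B k)]
    (𝔄 : Set (H →L[ℂ] H)) (V : ∀ k, A k ⊗[ℂ] B k →ₗᵢ[ℂ] H) : Prop where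
  orthogonal : ∀ j k, j ≠ k → ∀ x y, ⟪V j x, V k y⟫_ℂ = 0
  mem_iff : ∀ a : H →L[ℂ] H, a ∈ 𝔄 ↔
    ∃ b : ∀ k, B k →L[ℂ] B k, a = ∑ k, embed (V k) (TensorProduct.mapL 1 (b k))

end QuantumCodes

end

open scoped TensorProduct InnerProductSpace CStarAlgebra

noncomputable section

namespace QuantumCodes

open ContinuousLinearMap InnerProductSpace Module

/-! ### Complete positivity of `X ↦ S† X S` for `S` between different spaces. -/

section Compression

variable {H K : Type*}
  [NormedAddCommGroup H] [InnerProductSpace ℂ H] [CompleteSpace H]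
  [NormedAddCommGroup K] [InnerProductSpace ℂ K] [CompleteSpace K]

/-! On the multiplicative domain `E` is a star homomorphism, so `π(b) = E(V(I ⊗ b)V†)` (`codeRep`)
is a representation of `L(B)` on `H`, usually not unital. For a unit vector `β`, trace preservation
gives the projection `π(|β⟩⟨β|)` rank `dim A`. Moving its range around by the `π(|b⟩⟨β|)` yields an
isometry `W : A ⊗ B → H` intertwining `I ⊗ b` with `π(b)` and covering the range of `π(1)`
(`exists_isometry_intertwining`).

Every `E(V Y V†)` is fixed by `π(1)` on both sides, hence equals `W G(Y) W†` with `G(Y) = W† E(V Y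
V†) W`. The map `G` is an `I ⊗ L(B)`-bimodule map, so `G(a ⊗ I)` commutes with `I ⊗ L(B)` and has
the form `F(a) ⊗ I` (`eq_mapL_one_of_commute`). Therefore `G = F ⊗ id`. Any unitary extending `V z ↦
W z` serves as `U`. If `dim A = 1`, the channel `F` can only be the identity. -/

/-- The linear map `X ↦ S† X S`. -/
def conjAdjoint (S : K →L[ℂ] H) : (H →L[ℂ] H) →ₗ[ℂ] (K →L[ℂ] K) where
  toFun X := S.adjoint ∘L X ∘L S
  map_add' X Y := by ext; simp
  map_smul' c X := by ext; simp

theorem cstarMatrix_sum_apply {n σ R : Type*} [AddCommMonoid R] (s : Finset σ)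
    (f : σ → CStarMatrix n n R) (i j : n) : (∑ p ∈ s, f p) i j = ∑ p ∈ s, f p i j :=
  Matrix.sum_apply i j s f

/-- The Gram matrix is `N† N`, where `N` has the single nonzero row `a`. -/
theorem cstarMatrix_star_mul_nonneg {n R : Type*} [Fintype n] [NonUnitalCStarAlgebra R]
    [PartialOrder R] [StarOrderedRing R] (a : n → R) :
    (0 : CStarMatrix n n R) ≤ CStarMatrix.ofMatrix (fun i j => star (a i) * a j) := by
  classical
  rcases isEmpty_or_nonempty n with h | ⟨⟨i₀⟩⟩
  · exact le_of_eq (CStarMatrix.ext fun i => isEmptyElim i)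
  · let N : CStarMatrix n n R := CStarMatrix.ofMatrix fun i j => if i = i₀ then a j else 0
    convert star_mul_self_nonneg N
    ext i j
    rw [CStarMatrix.mul_apply]
    change star (a i) * a j =
      ∑ x, star (if x = i₀ then a i else 0) * (if x = i₀ then a j else 0)
    rw [Finset.sum_eq_single i₀ (fun x _ hx => by simp [hx]) (by simp)]
    simp

theorem exists_eq_star_mul_self {R : Type*} [NonUnitalCStarAlgebra R]
    [PartialOrder R] [StarOrderedRing R] {a : R} (h : 0 ≤ a) : ∃ b, a = star b * b :=
  CStarAlgebra.nonneg_iff_eq_star_mul_self.mp h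

/-- Inserting `∑ |e p⟩⟨e p| = 1` between the factors and routing through `β` replaces maps `K → H`
by elements of the C*-algebra `L(K)`. -/
theorem adjoint_comp_eq_sum_rankOne {κ : Type*} [Fintype κ] (e : OrthonormalBasis κ ℂ H)
    {β : K} (hβ : ‖β‖ = 1) (C D : K →L[ℂ] H) :
    C.adjoint ∘L D = ∑ p, star (rankOne ℂ β (e p) ∘L C) * (rankOne ℂ β (e p) ∘L D) := by
  ext x
  refine ext_inner_left ℂ fun y => ?_
  have hβ' : inner ℂ β β = (1 : ℂ) := by simp [inner_self_eq_norm_sq_to_K, hβ]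
  simp only [star_eq_adjoint, ContinuousLinearMap.mul_def, sum_apply, comp_apply, inner_sum,
    adjoint_inner_right, rankOne_apply, inner_smul_left, inner_smul_right, hβ', mul_one]
  rw [← e.sum_inner_mul_inner]
  simp [mul_comm]

/-- Writing `M = N† N`, the compressed matrix becomes a sum of Gram matrices over `L(K)`. -/
theorem conjAdjoint_map_nonneg [FiniteDimensional ℂ H] (S : K →L[ℂ] H) {n : Type*} [Fintype n]
    (M : CStarMatrix n n (H →L[ℂ] H)) (hM : 0 ≤ M) : 0 ≤ M.map (conjAdjoint S) := by
  classical
  rcases subsingleton_or_nontrivial K with hK | hK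
  · refine le_of_eq (CStarMatrix.ext fun i j => ?_)
    ext x
    exact Subsingleton.elim _ _
  obtain ⟨β, hβ⟩ := exists_norm_eq (E := K) (c := 1) zero_le_one
  obtain ⟨N, rfl⟩ := exists_eq_star_mul_self hM
  let e := stdOrthonormalBasis ℂ H
  let a : n → _ → n → (K →L[ℂ] K) := fun l p i => rankOne ℂ β (e p) ∘L N l i ∘L S
  have key : (star N * N).map (conjAdjoint S) =
      ∑ l, ∑ p, CStarMatrix.ofMatrix (fun i j => star (a l p i) * a l p j) := by
    ext i j : 1
    simp only [cstarMatrix_sum_apply, CStarMatrix.map_apply, CStarMatrix.mul_apply, map_sum]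
    refine Finset.sum_congr rfl fun l _ => ?_
    refine Eq.trans ?_ (adjoint_comp_eq_sum_rankOne e hβ (N l i ∘L S) (N l j ∘L S))
    rw [adjoint_comp]
    rfl
  rw [key]
  exact Finset.sum_nonneg fun l _ => Finset.sum_nonneg fun p _ => cstarMatrix_star_mul_nonneg _

end Compression

/-- Two isometries into a finite-dimensional space with the same source differ by a unitary. -/
theorem exists_unitary_comp_eq {H C : Type*}
    [NormedAddCommGroup H] [InnerProductSpace ℂ H] [CompleteSpace H] [FiniteDimensional ℂ H]
    [NormedAddCommGroup C] [InnerProductSpace ℂ C] (V W : C →ₗᵢ[ℂ] H) :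
    ∃ U ∈ unitary (H →L[ℂ] H), ∀ z, U (V z) = W z := by
  let e : C ≃ₗ[ℂ] LinearMap.range V.toLinearMap :=
    LinearEquiv.ofInjective V.toLinearMap V.injective
  have he : ∀ s, V (e.symm s) = (s : H) := fun s =>
    congrArg Subtype.val (e.apply_symm_apply s)
  let L : LinearMap.range V.toLinearMap →ₗᵢ[ℂ] H :=
    ⟨W.toLinearMap ∘ₗ e.symm.toLinearMap, fun s => by
      change ‖W (e.symm s)‖ = ‖(s : H)‖
      rw [W.norm_map, ← he, V.norm_map]⟩
  let U : H →L[ℂ] H := L.extend.toContinuousLinearMap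
  have hU : star U * U = 1 := by
    ext v
    refine ext_inner_right ℂ fun w => ?_
    rw [star_eq_adjoint, ContinuousLinearMap.mul_def, comp_apply, adjoint_inner_left]
    exact L.extend.inner_map_map v w
  refine ⟨U, ⟨hU, ?_⟩, fun z => ?_⟩
  -- In finite dimension a left inverse is also a right inverse.
  · have h : (U : H →ₗ[ℂ] H) * (star U : H →L[ℂ] H) = 1 := mul_eq_one_comm.mp <| by
      simpa using congrArg (fun T : H →L[ℂ] H => (T : H →ₗ[ℂ] H)) hU
    ext v
    exact LinearMap.congr_fun h v
  have := L.extend_apply (e z)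
  change L.extend (V z) = W (e.symm (e z)) at this
  rwa [e.symm_apply_apply] at this

/-! ### Operators supported on the code space, and their traces. -/

section Embed

variable {H A B : Type*}
  [NormedAddCommGroup H] [InnerProductSpace ℂ H] [CompleteSpace H]
  [NormedAddCommGroup A] [InnerProductSpace ℂ A] [FiniteDimensional ℂ A]
  [NormedAddCommGroup B] [InnerProductSpace ℂ B] [FiniteDimensional ℂ B]
  (V : A ⊗[ℂ] B →ₗᵢ[ℂ] H)

theorem adjoint_isometry_apply (z : A ⊗[ℂ] B) : V.toContinuousLinearMap.adjoint (V z) = z :=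
  ext_inner_right ℂ fun w => by
    rw [adjoint_inner_left]; exact V.inner_map_map z w

theorem embed_apply (Y : A ⊗[ℂ] B →L[ℂ] A ⊗[ℂ] B) (v : H) :
    embed V Y v = V (Y (V.toContinuousLinearMap.adjoint v)) := rfl

theorem embed_apply_isometry (Y : A ⊗[ℂ] B →L[ℂ] A ⊗[ℂ] B) (z : A ⊗[ℂ] B) :
    embed V Y (V z) = V (Y z) := by
  rw [embed_apply, adjoint_isometry_apply]

theorem embed_mul (Y Z : A ⊗[ℂ] B →L[ℂ] A ⊗[ℂ] B) :
    embed V Y * embed V Z = embed V (Y * Z) := by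
  ext v
  rw [ContinuousLinearMap.mul_def, comp_apply, embed_apply V Z, embed_apply_isometry]
  rfl

theorem star_embed (Y : A ⊗[ℂ] B →L[ℂ] A ⊗[ℂ] B) : star (embed V Y) = embed V (star Y) := by
  simp only [star_eq_adjoint, embed, adjoint_comp, adjoint_adjoint, comp_assoc]

theorem embed_compress (X : H →L[ℂ] H) :
    embed V (compress V X) = codeProjection V * X * codeProjection V := rfl

/-- `embed` as a linear map. -/
def embedₗ : (A ⊗[ℂ] B →L[ℂ] A ⊗[ℂ] B) →ₗ[ℂ] (H →L[ℂ] H) where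
  toFun := embed V
  map_add' X Y := by ext; simp [embed]
  map_smul' c X := by ext; simp [embed]

theorem embedₗ_apply (Y : A ⊗[ℂ] B →L[ℂ] A ⊗[ℂ] B) : embedₗ V Y = embed V Y := rfl

theorem trace_embed [FiniteDimensional ℂ H] (Y : A ⊗[ℂ] B →L[ℂ] A ⊗[ℂ] B) :
    LinearMap.trace ℂ H (embed V Y) = LinearMap.trace ℂ (A ⊗[ℂ] B) Y := by
  have : ((embed V Y : H →L[ℂ] H) : H →ₗ[ℂ] H) =
      V.toLinearMap ∘ₗ ((Y : A ⊗[ℂ] B →ₗ[ℂ] A ⊗[ℂ] B) ∘ₗ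
        (V.toContinuousLinearMap.adjoint : H →ₗ[ℂ] A ⊗[ℂ] B)) := rfl
  rw [this, LinearMap.trace_comp_comm']
  congr 1
  refine LinearMap.ext fun z => ?_
  simp [adjoint_isometry_apply]

theorem trace_mapL (a : A →L[ℂ] A) (b : B →L[ℂ] B) :
    LinearMap.trace ℂ (A ⊗[ℂ] B) (TensorProduct.mapL a b) =
      LinearMap.trace ℂ A a * LinearMap.trace ℂ B b := by
  rw [TensorProduct.toLinearMap_mapL, LinearMap.trace_tensorProduct']

theorem linearMap_ext_mapL {M : Type*} [AddCommGroup M] [Module ℂ M]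
    {f g : (A ⊗[ℂ] B →L[ℂ] A ⊗[ℂ] B) →ₗ[ℂ] M}
    (h : ∀ a b, f (TensorProduct.mapL a b) = g (TensorProduct.mapL a b)) : f = g := by
  have : f ∘ₗ (operatorTensorEquiv A B).toLinearMap = g ∘ₗ (operatorTensorEquiv A B).toLinearMap :=
    TensorProduct.ext' fun a b => by simpa [operatorTensorEquiv_tmul] using h a b
  ext1 Y
  simpa using LinearMap.congr_fun this ((operatorTensorEquiv A B).symm Y)

end Embed

theorem mapL_one_one {A B : Type*} [NormedAddCommGroup A] [InnerProductSpace ℂ A]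
    [NormedAddCommGroup B] [InnerProductSpace ℂ B] :
    TensorProduct.mapL (1 : A →L[ℂ] A) (1 : B →L[ℂ] B) = 1 :=
  TensorProduct.mapL_id_id

/-! ### The representation of `L(B)`, its intertwining isometry and the induced map on `L(A)`. -/

section Code

variable {H A B : Type*}
  [NormedAddCommGroup H] [InnerProductSpace ℂ H] [CompleteSpace H] [FiniteDimensional ℂ H]
  [NormedAddCommGroup A] [InnerProductSpace ℂ A] [CompleteSpace A] [FiniteDimensional ℂ A]
  [NormedAddCommGroup B] [InnerProductSpace ℂ B] [CompleteSpace B] [FiniteDimensional ℂ B]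

/-- The linear map `b ↦ E(V (I ⊗ b) V†)`. -/
def codeRep (E : (H →L[ℂ] H) →CP (H →L[ℂ] H)) (V : A ⊗[ℂ] B →ₗᵢ[ℂ] H) :
    (B →L[ℂ] B) →ₗ[ℂ] (H →L[ℂ] H) where
  toFun b := E (embed V (TensorProduct.mapL 1 b))
  map_add' b c := by
    rw [TensorProduct.mapL_add_right, ← map_add, ← embedₗ_apply, map_add]; rfl
  map_smul' r b := by
    rw [TensorProduct.mapL_smul_right, ← embedₗ_apply, map_smul, map_smul]; rfl

variable {E : (H →L[ℂ] H) →CP (H →L[ℂ] H)} {V : A ⊗[ℂ] B →ₗᵢ[ℂ] H}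

theorem codeRep_apply (b : B →L[ℂ] B) :
    codeRep E V b = E (embed V (TensorProduct.mapL 1 b)) := rfl

theorem star_codeRep (b : B →L[ℂ] B) : star (codeRep E V b) = codeRep E V (star b) := by
  rw [codeRep_apply, codeRep_apply, ← map_star, star_embed]
  simp only [star_eq_adjoint, TensorProduct.adjoint_mapL]
  rw [← star_eq_adjoint, star_one]

theorem codeRep_mul_map
    (hE : ∀ b : B →L[ℂ] B, embed V (TensorProduct.mapL 1 b) ∈ multiplicativeDomain E)
    (b : B →L[ℂ] B) (Y : A ⊗[ℂ] B →L[ℂ] A ⊗[ℂ] B) :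
    codeRep E V b * E (embed V Y) = E (embed V (TensorProduct.mapL 1 b * Y)) := by
  rw [codeRep_apply, (hE b _).1, embed_mul]

theorem map_mul_codeRep
    (hE : ∀ b : B →L[ℂ] B, embed V (TensorProduct.mapL 1 b) ∈ multiplicativeDomain E)
    (b : B →L[ℂ] B) (Y : A ⊗[ℂ] B →L[ℂ] A ⊗[ℂ] B) :
    E (embed V Y) * codeRep E V b = E (embed V (Y * TensorProduct.mapL 1 b)) := by
  rw [codeRep_apply, (hE b _).2, embed_mul]

theorem codeRep_mul
    (hE : ∀ b : B →L[ℂ] B, embed V (TensorProduct.mapL 1 b) ∈ multiplicativeDomain E)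
    (b c : B →L[ℂ] B) : codeRep E V b * codeRep E V c = codeRep E V (b * c) := by
  rw [codeRep_apply c, codeRep_mul_map hE, ← TensorProduct.mapL_mul, one_mul]; rfl

/-- The range of an idempotent whose trace is the dimension of `A` is isometric to `A`. -/
theorem exists_isometry_range_eq {f : H →L[ℂ] H} (hf : IsIdempotentElem f)
    (htr : LinearMap.trace ℂ H f = finrank ℂ A) :
    ∃ T : A →ₗᵢ[ℂ] H, (∀ x, f (T x) = T x) ∧ ∀ v, ∃ x, f v = T x := by
  have hf' : IsIdempotentElem (f : H →ₗ[ℂ] H) :=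
    congrArg (fun T : H →L[ℂ] H => (T : H →ₗ[ℂ] H)) hf
  have hp := LinearMap.IsIdempotentElem.isProj_range _ hf'
  have hd : finrank ℂ (LinearMap.range (f : H →ₗ[ℂ] H)) = finrank ℂ A := by
    exact_mod_cast hp.trace.symm.trans htr
  let e : A ≃ₗᵢ[ℂ] LinearMap.range (f : H →ₗ[ℂ] H) :=
    (stdOrthonormalBasis ℂ A).equiv (stdOrthonormalBasis ℂ _) (finCongr hd.symm)
  refine ⟨(Submodule.subtypeₗᵢ _).comp e.toLinearIsometry, fun x => hp.map_id _ (e x).2,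
    fun v => ⟨e.symm ⟨f v, v, rfl⟩, ?_⟩⟩
  simp

theorem trace_codeRep_rankOne (hTP : TracePreserving E) {β : B} (hβ : ‖β‖ = 1) :
    LinearMap.trace ℂ H (codeRep E V (rankOne ℂ β β)) = finrank ℂ A := by
  rw [codeRep_apply, hTP, trace_embed, trace_mapL, trace_rankOne]
  simp [inner_self_eq_norm_sq_to_K, hβ]

/-- An isometry of `A ⊗ B` onto the range of `codeRep E V 1` that intertwines the operators `I ⊗ b`
with the representation `codeRep`. -/
theorem exists_isometry_intertwining (hTP : TracePreserving E)
    (hE : ∀ b : B →L[ℂ] B, embed V (TensorProduct.mapL 1 b) ∈ multiplicativeDomain E)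
    {β : B} (hβ : ‖β‖ = 1) :
    ∃ W : A ⊗[ℂ] B →ₗᵢ[ℂ] H,
      (∀ b z, codeRep E V b (W z) = W (TensorProduct.mapL 1 b z)) ∧
      ∀ v, ∃ z, codeRep E V 1 v = W z := by
  have hββ : inner ℂ β β = (1 : ℂ) := by simp [inner_self_eq_norm_sq_to_K, hβ]
  have hmul : ∀ b c v, codeRep E V b (codeRep E V c v) = codeRep E V (b * c) v :=
    fun b c v => by rw [← codeRep_mul hE]; rfl
  have hf : IsIdempotentElem (codeRep E V (rankOne ℂ β β)) := by
    rw [IsIdempotentElem, codeRep_mul hE, (isIdempotentElem_rankOne_self hβ).eq]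
  obtain ⟨T, hT, hT'⟩ := exists_isometry_range_eq (A := A) hf (trace_codeRep_rankOne hTP hβ)
  let W₀ : A ⊗[ℂ] B →ₗ[ℂ] H := TensorProduct.lift
    (LinearMap.mk₂ ℂ (fun x b => codeRep E V (rankOne ℂ b β) (T x)) (by simp) (by simp)
      (by simp) (by simp))
  have hW₀ : ∀ x b, W₀ (x ⊗ₜ b) = codeRep E V (rankOne ℂ b β) (T x) := fun x b => by
    simp [W₀]
  have hinner : ∀ z w, inner ℂ (W₀ z) (W₀ w) = inner ℂ z w := by
    intro z w
    induction z with
    | zero => simp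
    | add z₁ z₂ h₁ h₂ => simp [inner_add_left, h₁, h₂]
    | tmul x b =>
      induction w with
      | zero => simp
      | add z₁ z₂ h₁ h₂ => simp [inner_add_right, h₁, h₂]
      -- `|b⟩⟨β|† |c⟩⟨β| = ⟨b, c⟩ |β⟩⟨β|`, and `π(|β⟩⟨β|)` fixes the range of `T`.
      | tmul y c =>
        rw [hW₀, hW₀, ← adjoint_inner_right, ← star_eq_adjoint, star_codeRep, hmul,
          star_eq_adjoint, adjoint_rankOne, ContinuousLinearMap.mul_def, rankOne_comp_rankOne,
          map_smul, smul_apply, hT, inner_smul_right, T.inner_map_map,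
          TensorProduct.inner_tmul, mul_comm]
  let W : A ⊗[ℂ] B →ₗᵢ[ℂ] H := W₀.isometryOfInner hinner
  have hW : ∀ z, W z = W₀ z := fun z => rfl
  have hWt : ∀ b z, codeRep E V b (W z) = W (TensorProduct.mapL 1 b z) := by
    intro b z
    rw [hW, hW]
    induction z with
    | zero => simp
    | add z₁ z₂ h₁ h₂ => simp only [map_add, h₁, h₂]
    | tmul x c =>
      rw [hW₀, hmul, TensorProduct.mapL_tmul, hW₀, ContinuousLinearMap.mul_def, comp_rankOne]; rfl
  refine ⟨W, hWt, fun v => ?_⟩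
  suffices h : codeRep E V 1 v ∈ LinearMap.range W.toLinearMap by
    obtain ⟨z, hz⟩ := h; exact ⟨z, hz.symm⟩
  -- Factoring `1` through `β` exhibits `π(1) v` as a sum of vectors `π(|e i⟩⟨β|) (T x)`, which are
  -- values of `W₀`.
  have h1 : (1 : B →L[ℂ] B) = ∑ i, rankOne ℂ (stdOrthonormalBasis ℂ B i) β *
      rankOne ℂ β (stdOrthonormalBasis ℂ B i) := by
    simp only [ContinuousLinearMap.mul_def, rankOne_comp_rankOne, hββ, one_smul]
    exact (OrthonormalBasis.sum_rankOne_eq_id _).symm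
  rw [h1, map_sum, sum_apply]
  refine Submodule.sum_mem _ fun i _ => ?_
  have h2 : rankOne ℂ β (stdOrthonormalBasis ℂ B i) =
      rankOne ℂ β β * rankOne ℂ β (stdOrthonormalBasis ℂ B i) := by
    rw [ContinuousLinearMap.mul_def, rankOne_comp_rankOne, hββ, one_smul]
  obtain ⟨x, hx⟩ := hT' (codeRep E V (rankOne ℂ β (stdOrthonormalBasis ℂ B i)) v)
  rw [h2, ← hmul, ← hmul, hx]
  exact ⟨x ⊗ₜ _, hW₀ _ _⟩

/-- An operator on `A ⊗ B` that commutes with `I ⊗ L(B)` has the form `a ⊗ I`. -/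
theorem eq_mapL_one_of_commute {β : B} (hβ : ‖β‖ = 1) {J : A →L[ℂ] A ⊗[ℂ] B}
    (hJ : ∀ x, J x = x ⊗ₜ β) {Z : A ⊗[ℂ] B →L[ℂ] A ⊗[ℂ] B}
    (hZ : ∀ b : B →L[ℂ] B, Z * TensorProduct.mapL 1 b = TensorProduct.mapL 1 b * Z) :
    Z = TensorProduct.mapL (J.adjoint ∘L Z ∘L J) 1 := by
  have hJt : ∀ (c : B) (z : A ⊗[ℂ] B),
      TensorProduct.mapL 1 (rankOne ℂ c β) z = J.adjoint z ⊗ₜ c := by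
    intro c z
    induction z with
    | zero => simp
    | add z₁ z₂ h₁ h₂ => simp only [map_add, h₁, h₂, TensorProduct.add_tmul]
    | tmul x b =>
      have : J.adjoint (x ⊗ₜ b) = inner ℂ β b • x := by
        refine ext_inner_left ℂ fun y => ?_
        rw [adjoint_inner_right, hJ, TensorProduct.inner_tmul, inner_smul_right, mul_comm]
      rw [TensorProduct.mapL_tmul, this, rankOne_apply, TensorProduct.tmul_smul,
        TensorProduct.smul_tmul']
      rfl
  have hββ : inner ℂ β β = (1 : ℂ) := by simp [inner_self_eq_norm_sq_to_K, hβ]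
  refine ContinuousLinearMap.coe_injective (TensorProduct.ext' fun x c => ?_)
  have h1 : x ⊗ₜ[ℂ] c = TensorProduct.mapL 1 (rankOne ℂ c β) (x ⊗ₜ[ℂ] β) := by
    rw [TensorProduct.mapL_tmul, rankOne_apply, hββ, one_smul]; rfl
  -- Since `x ⊗ c = (I ⊗ |c⟩⟨β|)(x ⊗ β)`, the value of `Z` there is determined by `Z (x ⊗ β)`.
  have h2 := DFunLike.congr_fun (hZ (rankOne ℂ c β)) (x ⊗ₜ β)
  simp only [ContinuousLinearMap.mul_def, comp_apply, ← h1] at h2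
  change Z (x ⊗ₜ c) = TensorProduct.mapL (J.adjoint ∘L Z ∘L J) 1 (x ⊗ₜ c)
  rw [h2, hJt, TensorProduct.mapL_tmul]
  simp [hJ]

/-- The map `a ↦ V (a ⊗ I) V†`, as a homomorphism of (non-unital) star algebras. -/
def ampliation (V : A ⊗[ℂ] B →ₗᵢ[ℂ] H) : (A →L[ℂ] A) →⋆ₙₐ[ℂ] (H →L[ℂ] H) where
  toFun a := embed V (TensorProduct.mapL a 1)
  map_smul' r a := by
    rw [TensorProduct.mapL_smul_left, ← embedₗ_apply, map_smul]; rfl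
  map_zero' := by rw [TensorProduct.mapL_zero_left, ← embedₗ_apply, map_zero]
  map_add' a b := by
    rw [TensorProduct.mapL_add_left, ← embedₗ_apply, map_add]; rfl
  map_mul' a b := by rw [embed_mul, ← TensorProduct.mapL_mul, one_mul]
  map_star' a := by
    rw [star_embed]
    simp only [star_eq_adjoint, TensorProduct.adjoint_mapL]
    rw [← star_eq_adjoint (1 : B →L[ℂ] B), star_one]

/-- The completely positive map `a ↦ S† E(V (a ⊗ I) V†) S`. -/
def reducedMap (E : (H →L[ℂ] H) →CP (H →L[ℂ] H)) (V : A ⊗[ℂ] B →ₗᵢ[ℂ] H) (S : A →L[ℂ] H) :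
    (A →L[ℂ] A) →CP (A →L[ℂ] A) where
  toLinearMap := conjAdjoint S ∘ₗ E.toLinearMap ∘ₗ
    { toFun := ampliation V, map_add' := map_add _, map_smul' := map_smul _ }
  map_cstarMatrix_nonneg' k M hM :=
    conjAdjoint_map_nonneg S _ (E.map_cstarMatrix_nonneg' k _
      (CompletelyPositiveMapClass.map_cstarMatrix_nonneg' (ampliation V) k M hM))

theorem reducedMap_apply (S : A →L[ℂ] H) (a : A →L[ℂ] A) :
    reducedMap E V S a = S.adjoint ∘L E (embed V (TensorProduct.mapL a 1)) ∘L S := rfl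

end Code

/-! ### Factoring `E` through `F ⊗ id`, and the subspace case. -/

section Correctable

variable {H A B : Type*}
  [NormedAddCommGroup H] [InnerProductSpace ℂ H] [CompleteSpace H]
  [NormedAddCommGroup A] [InnerProductSpace ℂ A] [FiniteDimensional ℂ A]
  [NormedAddCommGroup B] [InnerProductSpace ℂ B] [FiniteDimensional ℂ B]

theorem unitary_conj_embed {U : H →L[ℂ] H} {V W : A ⊗[ℂ] B →ₗᵢ[ℂ] H}
    (hU : ∀ z, U (V z) = W z) (Y : A ⊗[ℂ] B →L[ℂ] A ⊗[ℂ] B) :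
    U * embed V Y * star U = embed W Y := by
  have h : W.toContinuousLinearMap = U ∘L V.toContinuousLinearMap :=
    ContinuousLinearMap.ext fun z => (hU z).symm
  rw [embed, embed, h, adjoint_comp]
  rfl

theorem codeProjection_eq_starProjection (V : A ⊗[ℂ] B →ₗᵢ[ℂ] H)
    [(LinearMap.range V.toLinearMap).HasOrthogonalProjection] :
    codeProjection V = (LinearMap.range V.toLinearMap).starProjection := by
  ext v
  refine (Submodule.eq_starProjection_of_mem_of_inner_eq_zero
    (LinearMap.mem_range.2 ⟨V.toContinuousLinearMap.adjoint v, rfl⟩) ?_).symm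
  rintro _ ⟨z, rfl⟩
  change inner ℂ (v - V (V.toContinuousLinearMap.adjoint v)) (V z) = 0
  rw [inner_sub_left, V.inner_map_map, adjoint_inner_left]
  exact sub_self _

/-- Treated apart because `B = 0` has no unit vector `β`; both sides vanish, so identity maps
suffice. -/
theorem isUnitarilyCorrectable_of_subsingleton [CompleteSpace A] [Subsingleton B]
    (E : (H →L[ℂ] H) →CP (H →L[ℂ] H)) (V : A ⊗[ℂ] B →ₗᵢ[ℂ] H) : IsUnitarilyCorrectable E V := by
  have hsub : Subsingleton (A ⊗[ℂ] B) := by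
    refine subsingleton_of_forall_eq 0 fun z => ?_
    induction z with
    | zero => rfl
    | add x y hx hy => rw [hx, hy, add_zero]
    | tmul x y => rw [Subsingleton.elim y 0, TensorProduct.tmul_zero]
  have h0 : ∀ Y, embed V Y = 0 := fun Y => by
    ext v
    rw [embed_apply, Subsingleton.elim (Y _) 0, map_zero]; rfl
  refine ⟨1, one_mem _, ((NonUnitalStarAlgHom.id ℂ (A →L[ℂ] A) :
    (A →L[ℂ] A) →⋆ₙₐ[ℂ] (A →L[ℂ] A)) : (A →L[ℂ] A) →CP (A →L[ℂ] A)), fun _ => rfl, fun X => ?_⟩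
  rw [codeProjection, h0, h0]
  simp

theorem isUnitarilyCorrectable_of_mem_multiplicativeDomain [FiniteDimensional ℂ H]
    [CompleteSpace A] {E : (H →L[ℂ] H) →CP (H →L[ℂ] H)} (hTP : TracePreserving E)
    {V : A ⊗[ℂ] B →ₗᵢ[ℂ] H}
    (hE : ∀ b : B →L[ℂ] B, embed V (TensorProduct.mapL 1 b) ∈ multiplicativeDomain E) :
    IsUnitarilyCorrectable E V := by
  rcases subsingleton_or_nontrivial B with hB | hB
  · exact isUnitarilyCorrectable_of_subsingleton E V
  have : CompleteSpace B := FiniteDimensional.complete ℂ B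
  obtain ⟨β, hβ⟩ := exists_norm_eq (E := B) (c := 1) zero_le_one
  obtain ⟨W, hW, hWr⟩ := exists_isometry_intertwining hTP hE hβ
  obtain ⟨U, hU, hUV⟩ := exists_unitary_comp_eq V W
  let J : A →L[ℂ] A ⊗[ℂ] B := LinearMap.toContinuousLinearMap ((TensorProduct.mk ℂ A B).flip β)
  have hJ : ∀ x, J x = x ⊗ₜ β := fun x => rfl
  let F := reducedMap E V (W.toContinuousLinearMap ∘L J)
  have hWadj : ∀ b v, W.toContinuousLinearMap.adjoint (codeRep E V b v) =
      TensorProduct.mapL 1 b (W.toContinuousLinearMap.adjoint v) := by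
    intro b v
    refine ext_inner_left ℂ fun z => ?_
    rw [adjoint_inner_right, ← adjoint_inner_left (codeRep E V b), ← star_eq_adjoint,
      star_codeRep]
    change inner ℂ (codeRep E V (star b) (W z)) v = _
    rw [hW, ← adjoint_inner_left (TensorProduct.mapL 1 b), TensorProduct.adjoint_mapL,
      adjoint_inner_right, ← star_eq_adjoint, ← star_eq_adjoint, star_one]
    rfl
  have hG_right : ∀ Y b, compress W (E (embed V Y)) * TensorProduct.mapL 1 b =
      compress W (E (embed V (Y * TensorProduct.mapL 1 b))) := by
    intro Y b
    rw [← map_mul_codeRep hE]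
    ext1 z
    change W.toContinuousLinearMap.adjoint (E (embed V Y) (W (TensorProduct.mapL 1 b z))) = _
    rw [← hW]
    rfl
  have hG_left : ∀ Y b, TensorProduct.mapL 1 b * compress W (E (embed V Y)) =
      compress W (E (embed V (TensorProduct.mapL 1 b * Y))) := by
    intro Y b
    rw [← codeRep_mul_map hE]
    ext1 z
    exact (hWadj b _).symm
  have hG_one : ∀ a, compress W (E (embed V (TensorProduct.mapL a 1))) =
      TensorProduct.mapL (F a) 1 := by
    intro a
    rw [eq_mapL_one_of_commute hβ hJ (Z := compress W (E (embed V (TensorProduct.mapL a 1))))]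
    · rw [reducedMap_apply, adjoint_comp]
      rfl
    · intro b
      rw [hG_right, hG_left, ← TensorProduct.mapL_mul, ← TensorProduct.mapL_mul]
      simp only [one_mul, mul_one]
  have hG : ∀ Y, compress W (E (embed V Y)) = tensorId F.toLinearMap Y := by
    let G : (A ⊗[ℂ] B →L[ℂ] A ⊗[ℂ] B) →ₗ[ℂ] (A ⊗[ℂ] B →L[ℂ] A ⊗[ℂ] B) :=
      conjAdjoint W.toContinuousLinearMap ∘ₗ E.toLinearMap ∘ₗ embedₗ V
    have : G = tensorId F.toLinearMap := linearMap_ext_mapL fun a b => by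
      change compress W (E (embed V _)) = _
      have hab : TensorProduct.mapL a b = TensorProduct.mapL a 1 * TensorProduct.mapL 1 b := by
        rw [← TensorProduct.mapL_mul, one_mul, mul_one]
      rw [tensorId_mapL, hab, ← hG_right, hG_one, ← TensorProduct.mapL_mul, one_mul, mul_one]
      rfl
    exact LinearMap.congr_fun this
  have hP : codeProjection W * codeRep E V 1 = codeRep E V 1 := by
    ext v
    obtain ⟨z, hz⟩ := hWr v
    change codeProjection W (codeRep E V 1 v) = codeRep E V 1 v
    rw [hz, codeProjection, embed_apply_isometry]
    rfl
  have hP' : codeRep E V 1 * codeProjection W = codeRep E V 1 := by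
    have h := congrArg star hP
    have h1 : star (codeProjection W) = codeProjection W :=
      (star_embed W 1).trans (congrArg (embed W) (star_one (A ⊗[ℂ] B →L[ℂ] A ⊗[ℂ] B)))
    rwa [star_mul, star_codeRep, star_one, h1] at h
  have hEW : ∀ Y, E (embed V Y) = embed W (compress W (E (embed V Y))) := by
    intro Y
    have hl : codeRep E V 1 * E (embed V Y) = E (embed V Y) := by
      rw [codeRep_mul_map hE, mapL_one_one, one_mul]
    have hr : E (embed V Y) * codeRep E V 1 = E (embed V Y) := by
      rw [map_mul_codeRep hE, mapL_one_one, mul_one]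
    rw [embed_compress]
    nth_rw 2 [← hl]
    rw [← mul_assoc, hP, hl]
    nth_rw 2 [← hr]
    rw [mul_assoc, hP', hr]
  refine ⟨U, hU, F, fun a => ?_, fun X => ?_⟩
  -- Comparing traces of `a ⊗ I` and `F(a) ⊗ I` gives the claim multiplied by `dim B`, which is
  -- nonzero here.
  · have h := trace_mapL (F a) (1 : B →L[ℂ] B)
    rw [← hG_one, ← trace_embed W, ← hEW, hTP, trace_embed, trace_mapL] at h
    refine (mul_right_cancel₀ ?_ h).symm
    have : LinearMap.trace ℂ B ((1 : B →L[ℂ] B) : B →ₗ[ℂ] B) = finrank ℂ B :=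
      LinearMap.trace_one ℂ B
    rw [this]
    exact_mod_cast finrank_pos.ne'
  · rw [unitary_conj_embed hUV, ← hG, ← embed_compress, ← hEW]

theorem IsBlockDecomposition.embed_mem {ι : Type*} [Fintype ι] {A B : ι → Type*}
    [∀ k, NormedAddCommGroup (A k)] [∀ k, InnerProductSpace ℂ (A k)]
    [∀ k, FiniteDimensional ℂ (A k)]
    [∀ k, NormedAddCommGroup (B k)] [∀ k, InnerProductSpace ℂ (B k)]
    [∀ k, FiniteDimensional ℂ (B k)]
    {𝔄 : Set (H →L[ℂ] H)} {V : ∀ k, A k ⊗[ℂ] B k →ₗᵢ[ℂ] H} (hV : IsBlockDecomposition 𝔄 V)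
    (k : ι) (b : B k →L[ℂ] B k) : embed (V k) (TensorProduct.mapL 1 b) ∈ 𝔄 := by
  classical
  refine (hV.mem_iff _).2 ⟨Pi.single k b, ?_⟩
  rw [Finset.sum_eq_single k]
  · rw [Pi.single_eq_same]
  · intro j _ hj
    rw [Pi.single_eq_of_ne hj, TensorProduct.mapL_zero_right, ← embedₗ_apply, map_zero]
  · simp

/-- On a line, every operator is its trace times the identity. -/
theorem linearMap_eq_id_of_tracePreserving (hA : finrank ℂ A = 1)
    {F : (A →L[ℂ] A) →ₗ[ℂ] (A →L[ℂ] A)} (hF : TracePreserving F) : F = LinearMap.id := by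
  have key : ∀ a : A →L[ℂ] A, a = LinearMap.trace ℂ A a • (1 : A →L[ℂ] A) := by
    intro a
    obtain ⟨v, -, hv⟩ := finrank_eq_one_iff'.mp hA
    obtain ⟨c, hc⟩ := hv (a v)
    have ha : a = c • (1 : A →L[ℂ] A) := by
      ext w
      obtain ⟨d, rfl⟩ := hv w
      rw [map_smul, ← hc, smul_comm]
      rfl
    have ht : LinearMap.trace ℂ A a = c := by
      rw [ha]
      change LinearMap.trace ℂ A (c • (1 : A →ₗ[ℂ] A)) = c
      rw [map_smul, LinearMap.trace_one, hA]
      simp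
    rw [ht, ← ha]
  ext1 a
  rw [key (F a), hF a, ← key a]
  rfl

theorem IsUnitarilyCorrectable.subspace [FiniteDimensional ℂ H] [CompleteSpace A]
    {E : (H →L[ℂ] H) →CP (H →L[ℂ] H)} {V : A ⊗[ℂ] B →ₗᵢ[ℂ] H}
    (h : IsUnitarilyCorrectable E V) (hA : finrank ℂ A = 1) :
    IsUnitarilyCorrectableSubspace E (LinearMap.range V.toLinearMap) := by
  obtain ⟨U, hU, F, hF, hUF⟩ := h
  refine ⟨U, hU, fun X => ?_⟩
  have hid : tensorId (B := B) F.toLinearMap = LinearMap.id := by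
    refine linearMap_ext_mapL fun a b => ?_
    rw [tensorId_mapL, linearMap_eq_id_of_tracePreserving hA (F := F.toLinearMap) hF]
    rfl
  rw [← codeProjection_eq_starProjection, hUF, hid, ← embed_compress]
  rfl

end Correctable

end QuantumCodes

end

theorem theorem3p4 {H ι : Type*} [Fintype ι] {A B : ι → Type*}
    [NormedAddCommGroup H] [InnerProductSpace ℂ H] [CompleteSpace H] [FiniteDimensional ℂ H]
    [∀ k, NormedAddCommGroup (A k)] [∀ k, InnerProductSpace ℂ (A k)]
    [∀ k, CompleteSpace (A k)] [∀ k, FiniteDimensional ℂ (A k)]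
    [∀ k, NormedAddCommGroup (B k)] [∀ k, InnerProductSpace ℂ (B k)]
    [∀ k, FiniteDimensional ℂ (B k)]
    (E : (H →L[ℂ] H) →CP (H →L[ℂ] H)) (hE : QuantumCodes.TracePreserving E)
    (V : ∀ k, A k ⊗[ℂ] B k →ₗᵢ[ℂ] H)
    (hV : QuantumCodes.IsBlockDecomposition (QuantumCodes.multiplicativeDomain E) V) (k : ι) :
    QuantumCodes.IsUnitarilyCorrectable E (V k) ∧
      (Module.finrank ℂ (A k) = 1 →
        QuantumCodes.IsUnitarilyCorrectableSubspace E (LinearMap.range (V k).toLinearMap)) := by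
  have h := QuantumCodes.isUnitarilyCorrectable_of_mem_multiplicativeDomain hE (hV.embed_mem k)
  exact ⟨h, h.subspace⟩
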